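/- For finite alphabets $B_1,\dots,B_k$ let $A = B_1\times\cdots\times B_k$ and let $\mathrm{Aut}(A^{\mathbb Z})$ be the group of self-homeomorphisms of $A^{\mathbb Z}$ (product topology, $A$ discrete) that commute with the shift $\sigma(x)_i = x_{i+1}$. Let $\mathrm{PAut}[B_1;\dots;B_k]$ be the subgroup of $\mathrm{Aut}(A^{\mathbb Z})$ generated by the partial shifts $\sigma_i$ (which apply the shift to the $i$-th component of the configuration and leave the other components unchanged) and the symbol permutations (which apply one permutation of $A$ in every cell). Write $\mathrm{PAut}[n_1;\dots;n_k]$ for this group, up to isomorphism, when $|B_i| = n_i$. A group is called linear if it is isomorphic to a subgroup of $\mathrm{GL}(d,F)$ for some field $F$ and some $d\in\mathbb N$; it is called a subdirect product of linear groups if it is isomorphic to a subgroup of a direct product $H_1\times\cdots\times H_r$ of finitely many linear groups. Theorem. Let $m, n \ge 1$. 1. $\mathrm{PAut}[m]\cong \mathrm{PAut}[1;m]$, and if $m\ge 2$, then both groups are isomorphic to $\mathbb Z\times S_m$. 2. If $m\ge 2$ and $n\ge 2$, then $\mathrm{PAut}[m;n]$ is not amenable. 3. $\mathrm{PAut}[2;2]$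 is a linear group. 4. If $m\ge 2$ and $n\ge 3$, then $\mathrm{PAut}[m;n]$ is not a subdirect product of linear groups. -/

import Mathlib

/-- The shift `σ(x)_i = x_{i+1}` on `A^ℤ`, as a self-homeomorphism. -/
def shiftHomeo (A : Type*) [TopologicalSpace A] : (ℤ → A) ≃ₜ (ℤ → A) where
  toFun x i := x (i + 1)
  invFun x i := x (i - 1)
  left_inv x := by funext i; simp
  right_inv x := by funext i; simp
  continuous_toFun := by fun_prop
  continuous_invFun := by fun_prop

/-- The group `RCA(A) = Aut(A^ℤ)` of reversible cellular automata on the alphabet `A`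
(to be used with the discrete topology): the self-homeomorphisms of `A^ℤ` that commute with
the shift, under composition. -/
def RCA (A : Type*) [TopologicalSpace A] : Subgroup ((ℤ → A) ≃ₜ (ℤ → A)) :=
  Subgroup.centralizer {shiftHomeo A}

section PAut

variable {k : ℕ} (B : Fin k → Type*) [∀ i, TopologicalSpace (B i)]

/-- The partial shift `σ_i` as a homeomorphism of `(B_1 × ⋯ × B_k)^ℤ`: it shifts the `i`-th track
and leaves the other tracks unchanged. -/
def partialShiftHomeo (i : Fin k) : (ℤ → ∀ t, B t) ≃ₜ (ℤ → ∀ t, B t) where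
  toFun x j := Function.update (x j) i (x (j + 1) i)
  invFun x j := Function.update (x j) i (x (j - 1) i)
  left_inv x := by funext j; simp
  right_inv x := by funext j; simp
  continuous_toFun := by fun_prop
  continuous_invFun := by fun_prop

/-- The partial shift `σ_i` as an element of `Aut((B_1 × ⋯ × B_k)^ℤ)`. -/
def partialShift (i : Fin k) : RCA (∀ t, B t) :=
  ⟨partialShiftHomeo B i, by
    rw [RCA, Subgroup.mem_centralizer_iff]
    rintro _ rfl
    rfl⟩

variable [∀ i, DiscreteTopology (B i)]

/-- The symbol permutation given by a permutation `π` of `B_1 × ⋯ × B_k`, applied in every cell,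
as a homeomorphism. -/
def symbolPermHomeo (π : Equiv.Perm (∀ t, B t)) : (ℤ → ∀ t, B t) ≃ₜ (ℤ → ∀ t, B t) where
  toFun x j := π (x j)
  invFun x j := π.symm (x j)
  left_inv x := by funext j; simp
  right_inv x := by funext j; simp
  continuous_toFun :=
    continuous_pi fun j => (continuous_of_discreteTopology (f := π)).comp (continuous_apply j)
  continuous_invFun :=
    continuous_pi fun j => (continuous_of_discreteTopology (f := π.symm)).comp (continuous_apply j)

/-- The symbol permutation given by `π` as an element of `Aut((B_1 × ⋯ × B_k)^ℤ)`. -/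
def symbolPerm (π : Equiv.Perm (∀ t, B t)) : RCA (∀ t, B t) :=
  ⟨symbolPermHomeo B π, by
    rw [RCA, Subgroup.mem_centralizer_iff]
    rintro _ rfl
    rfl⟩

/-- `PAut[B_1; …; B_k]`: the smallest subgroup of `Aut((B_1 × ⋯ × B_k)^ℤ)` that contains all
partial shifts and all symbol permutations. -/
def PAut : Subgroup (RCA (∀ t, B t)) :=
  Subgroup.closure (Set.range (partialShift B) ∪ Set.range (symbolPerm B))

end PAut

/-- `PAut[n_1; …; n_k]`: the group `PAut[B_1; …; B_k]` for alphabets `B_i = {0, …, n_i - 1}`. -/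
abbrev PAutN {k : ℕ} (n : Fin k → ℕ) : Subgroup (RCA (∀ t, Fin (n t))) :=
  PAut fun t => Fin (n t)

/-- A (discrete) group is amenable if it carries a finitely additive, left-invariant probability
measure defined on all of its subsets. -/
def IsAmenableGroup (G : Type*) [Group G] : Prop :=
  ∃ μ : Set G → ℝ, (∀ s, 0 ≤ μ s) ∧ μ Set.univ = 1 ∧
    (∀ s t, Disjoint s t → μ (s ∪ t) = μ s + μ t) ∧
    ∀ (g : G) (s : Set G), μ ((fun x => g * x) '' s) = μ s

/-- A group is linear if it is isomorphic to a subgroup of `GL(d, F)` for some field `F`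
(in the universe `v`) and some `d : ℕ`. -/
def IsLinearGroup.{v, u} (G : Type u) [Group G] : Prop :=
  ∃ (F : Type v) (_ : Field F) (d : ℕ) (f : G →* Matrix.GeneralLinearGroup (Fin d) F),
    Function.Injective f

/-- A group is a subdirect product of (finitely many) linear groups if it is isomorphic to a
subgroup of `H_1 × ⋯ × H_r` for some linear groups `H_1, …, H_r`. -/
def IsSubdirectProductOfLinearGroups.{v, u} (G : Type u) [Group G] : Prop :=
  ∃ (r : ℕ) (H : Fin r → Type v) (_ : ∀ i, Group (H i)) (f : G →* ∀ i, H i),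
    (∀ i, IsLinearGroup.{v} (H i)) ∧ Function.Injective f

universe v

/-!
For a two-track alphabet `B 0 × B 1` the group `PAut` has three different kinds of behaviour.

* If all tracks but one are trivial, one partial shift is the shift and the others are the identity.
  The shift commutes with symbol permutations, which gives `ℤ × Sym(A)`
  (`nonempty_pAut_mulEquiv_int_prod_perm`).

* If both tracks are nontrivial, choose symbols `0, 1` on each. On the configurations over
  `{0, 1}²` that are not zero but are zero far to the right, look at the rightmost nonzero symbol.
  A symbol permutation that cycles `(1,0) → (0,1) → (1,1) → (1,0)` permutes the three possibilities
  cyclically, so an invariant mean would give each the weight `1/3`. The exchange of `(1,0)` and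
  `(0,1)`, followed by moving the first track one cell to the right, sends the last two
  possibilities into the first (`not_isAmenableGroup_pAut`).

* If both tracks are binary, all symbol permutations are affine over `𝔽₂`
  (`perm_add_of_card_eq_two`). The linear part of an element of `PAut` acts on the configurations
  with left-bounded support, that is, on pairs of Laurent series, by a matrix over the field
  `𝔽₂((x))`. Together with the permutation action on constant configurations, which records the
  translation part, it determines the element (`isLinearGroup_pAut_of_card_eq_two`).

* If the second track has three symbols, choose on it a 3-cycle `α` and a transposition `β` with
  `β α β⁻¹ α⁻¹ = α`. Iterated commutators give an automaton `a n` that applies `α` where the first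
  track shows `n` zeros, while `b n` applies `β` where the first track shows a `1` at distance `n`.
  Then `a i` commutes with `b j` for `j < i`, but not with `b i`. Centralizers in finite products of
  matrix groups satisfy the descending chain condition, so such elements cannot exist there
  (`not_isSubdirectProductOfLinearGroups_of_ladder`).
-/

/-! ### Evaluation of cellular automata -/

section Evaluation

variable {A : Type*} [TopologicalSpace A]

theorem RCA.mul_apply (g h : RCA A) (x : ℤ → A) : (g * h).1 x = g.1 (h.1 x) := rfl

theorem RCA.ext_apply {g h : RCA A} (H : ∀ x j, g.1 x j = h.1 x j) : g = h :=
  Subtype.ext (Homeomorph.ext fun x => funext (H x))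

theorem RCA.inv_apply_apply (g : RCA A) (x : ℤ → A) : (g⁻¹).1 (g.1 x) = x :=
  g.1.symm_apply_apply x

theorem RCA.apply_inv_apply (g : RCA A) (x : ℤ → A) : g.1 ((g⁻¹).1 x) = x :=
  g.1.apply_symm_apply x

theorem RCA.apply_shift (g : RCA A) (x : ℤ → A) :
    g.1 (fun j => x (j + 1)) = fun j => g.1 x (j + 1) := by
  have h := Subgroup.mem_centralizer_iff.1 g.2 _ rfl
  exact (congrArg (fun f : (ℤ → A) ≃ₜ (ℤ → A) => f x) h).symm

variable {k : ℕ} (B : Fin k → Type*) [∀ i, TopologicalSpace (B i)]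

theorem partialShift_apply (i : Fin k) (x : ℤ → ∀ t, B t) (j : ℤ) :
    (partialShift B i).1 x j = Function.update (x j) i (x (j + 1) i) := rfl

theorem partialShift_inv_apply (i : Fin k) (x : ℤ → ∀ t, B t) (j : ℤ) :
    ((partialShift B i)⁻¹).1 x j = Function.update (x j) i (x (j - 1) i) := rfl

theorem partialShift_mem (i : Fin k) [∀ i, DiscreteTopology (B i)] :
    partialShift B i ∈ PAut B :=
  Subgroup.subset_closure (Or.inl ⟨i, rfl⟩)

variable [∀ i, DiscreteTopology (B i)]

theorem symbolPerm_apply (π : Equiv.Perm (∀ t, B t)) (x : ℤ → ∀ t, B t) (j : ℤ) :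
    (symbolPerm B π).1 x j = π (x j) := rfl

theorem symbolPerm_mem (π : Equiv.Perm (∀ t, B t)) : symbolPerm B π ∈ PAut B :=
  Subgroup.subset_closure (Or.inr ⟨π, rfl⟩)

end Evaluation

/-! ### Alphabets with at most one nontrivial factor -/

section OneTrack

variable {k : ℕ} (B : Fin k → Type*) [∀ i, TopologicalSpace (B i)] [∀ i, DiscreteTopology (B i)]

/-- Symbol permutations form a copy of the symmetric group of the alphabet. -/
def symbolPermHom : Equiv.Perm (∀ t, B t) →* RCA (∀ t, B t) where
  toFun := symbolPerm B
  map_one' := rfl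
  map_mul' _ _ := rfl

theorem symbolPermHom_apply (π : Equiv.Perm (∀ t, B t)) (x : ℤ → ∀ t, B t) (j : ℤ) :
    (symbolPermHom B π).1 x j = π (x j) := rfl

variable {B} {i₀ : Fin k}

omit [∀ i, DiscreteTopology (B i)] in
theorem partialShift_apply_of_subsingleton (hB : ∀ t, t ≠ i₀ → Subsingleton (B t))
    (x : ℤ → ∀ t, B t) (j : ℤ) :
    (partialShift B i₀).1 x j = x (j + 1) := by
  funext t
  rw [partialShift_apply]
  by_cases h : t = i₀
  · subst h; simp
  · exact (hB t h).elim _ _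

omit [∀ i, DiscreteTopology (B i)] in
theorem partialShift_zpow_apply_of_subsingleton (hB : ∀ t, t ≠ i₀ → Subsingleton (B t))
    (n : ℤ) (x : ℤ → ∀ t, B t) (j : ℤ) :
    (partialShift B i₀ ^ n).1 x j = x (j + n) := by
  induction n generalizing x j with
  | zero => simp
  | succ n ih =>
    rw [zpow_add_one, RCA.mul_apply, ih, partialShift_apply_of_subsingleton hB, add_assoc]
  | pred n ih =>
    have h : ∀ y j, ((partialShift B i₀)⁻¹).1 y j = y (j - 1) := fun y j => by
      conv_rhs => rw [← RCA.apply_inv_apply (partialShift B i₀) y]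
      rw [partialShift_apply_of_subsingleton hB, sub_add_cancel]
    rw [zpow_sub_one, RCA.mul_apply, ih, h, add_sub_assoc]

/-- With a single nontrivial factor, `(n, π) ↦ σⁿ π` identifies `PAut` with `ℤ × Sym(A)`. -/
theorem nonempty_pAut_mulEquiv_int_prod_perm (hB : ∀ t, t ≠ i₀ → Subsingleton (B t))
    [Nontrivial (∀ t, B t)] :
    Nonempty (PAut B ≃* Multiplicative ℤ × Equiv.Perm (∀ t, B t)) := by
  have hcomm : ∀ n π, Commute (zpowersHom _ (partialShift B i₀) n) (symbolPermHom B π) := fun n π =>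
    RCA.ext_apply fun x j => by
      simp only [zpowersHom_apply, RCA.mul_apply, symbolPermHom_apply,
        partialShift_zpow_apply_of_subsingleton hB]
  let f : Multiplicative ℤ × Equiv.Perm (∀ t, B t) →* RCA (∀ t, B t) :=
    (zpowersHom _ (partialShift B i₀)).noncommCoprod (symbolPermHom B) hcomm
  have hf : ∀ p x j, (f p).1 x j = p.2 (x (j + p.1.toAdd)) := fun p x j =>
    partialShift_zpow_apply_of_subsingleton hB _ _ _
  have hinj : Function.Injective f := by
    rw [injective_iff_map_eq_one]
    rintro ⟨n, π⟩ h
    have h' : ∀ (x : ℤ → ∀ t, B t) j, π (x (j + n.toAdd)) = x j := fun x j => by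
      rw [← hf (n, π), h]; rfl
    obtain rfl : π = 1 := Equiv.ext fun a => h' (fun _ => a) 0
    obtain ⟨a, b, hab⟩ := exists_pair_ne (∀ t, B t)
    have hn := h' (Function.update (fun _ => a) 0 b) 0
    have : n.toAdd = 0 := by
      by_contra hne
      simp [Function.update_of_ne hne] at hn
      exact hab hn
    exact Prod.ext (toAdd_eq_zero.1 this) rfl
  have hrange : PAut B = f.range := by
    apply le_antisymm
    · rw [PAut, Subgroup.closure_le]
      rintro _ (⟨i, rfl⟩ | ⟨π, rfl⟩)
      · by_cases hi : i = i₀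
        · subst hi
          exact ⟨(Multiplicative.ofAdd 1, 1), RCA.ext_apply fun x j => by
            rw [hf, partialShift_apply_of_subsingleton hB]; rfl⟩
        · refine ⟨1, RCA.ext_apply fun x j => ?_⟩
          have := hB i hi
          rw [map_one, partialShift_apply, Subsingleton.elim (x (j + 1) i) (x j i),
            Function.update_eq_self]
          rfl
      · exact ⟨(1, π), RCA.ext_apply fun x j => by rw [hf, symbolPerm_apply]; simp⟩
    · rintro _ ⟨⟨n, π⟩, rfl⟩
      exact mul_mem (zpow_mem (partialShift_mem B i₀) _) (symbolPerm_mem B π)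
  exact ⟨(MulEquiv.subgroupCongr hrange).trans (MonoidHom.ofInjective hinj).symm⟩

end OneTrack

theorem nonempty_pAutN_one_track {m : ℕ} (hm : 2 ≤ m) :
    Nonempty (PAutN ![m] ≃* Multiplicative ℤ × Equiv.Perm (Fin m)) := by
  let e : (∀ t : Fin 1, Fin (![m] t)) ≃ Fin m := Equiv.piUnique _
  have : Nontrivial (Fin m) := Fin.nontrivial_iff_two_le.2 hm
  have := e.nontrivial
  obtain ⟨f⟩ := nonempty_pAut_mulEquiv_int_prod_perm (B := fun t : Fin 1 => Fin (![m] t)) (i₀ := 0)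
    fun t ht => (ht (Subsingleton.elim _ _)).elim
  exact ⟨f.trans (MulEquiv.prodCongr (MulEquiv.refl _) e.permCongrHom)⟩

theorem nonempty_pAutN_trivial_track {m : ℕ} (hm : 2 ≤ m) :
    Nonempty (PAutN ![1, m] ≃* Multiplicative ℤ × Equiv.Perm (Fin m)) := by
  let e : (∀ t : Fin 2, Fin (![1, m] t)) ≃ Fin m :=
    (piFinTwoEquiv _).trans (Equiv.uniqueProd (Fin m) (Fin 1))
  have : Nontrivial (Fin m) := Fin.nontrivial_iff_two_le.2 hm
  have := e.nontrivial
  obtain ⟨f⟩ := nonempty_pAut_mulEquiv_int_prod_perm (B := fun t : Fin 2 => Fin (![1, m] t))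
    (i₀ := 1) fun t ht => by
      obtain rfl : t = 0 := by omega
      exact inferInstanceAs (Subsingleton (Fin 1))
  exact ⟨f.trans (MulEquiv.prodCongr (MulEquiv.refl _) e.permCongrHom)⟩

theorem nonempty_pAutN_one_track_mulEquiv {m : ℕ} (hm : 1 ≤ m) :
    Nonempty (PAutN ![m] ≃* PAutN ![1, m]) := by
  obtain rfl | hm := hm.eq_or_lt
  · -- Both configuration spaces are single points, so both groups are trivial.
    have h1 : Subsingleton (∀ t : Fin 1, Fin (![1] t)) :=
      (Equiv.piUnique fun t : Fin 1 => Fin (![1] t)).subsingleton_congr.2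
        (inferInstanceAs (Subsingleton (Fin 1)))
    have h2 : Subsingleton (∀ t : Fin 2, Fin (![1, 1] t)) :=
      (piFinTwoEquiv fun t : Fin 2 => Fin (![1, 1] t)).subsingleton_congr.2
        (inferInstanceAs (Subsingleton (Fin 1 × Fin 1)))
    exact ⟨{
      toFun _ := 1
      invFun _ := 1
      left_inv _ := Subtype.ext (RCA.ext_apply fun _ _ => Subsingleton.elim _ _)
      right_inv _ := Subtype.ext (RCA.ext_apply fun _ _ => Subsingleton.elim _ _)
      map_mul' _ _ := (mul_one _).symm }⟩
  · obtain ⟨f⟩ := nonempty_pAutN_one_track hm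
    obtain ⟨g⟩ := nonempty_pAutN_trivial_track hm
    exact ⟨f.trans g.symm⟩

open scoped Pointwise

/-! ### A paradoxical action that excludes invariant means -/

/-- An invariant mean on `G` restricts to the stabilizer of `X` (through a transversal), and is then
transported to `X` by an orbit map. There `s` gives `ν(X ∖ P) ≤ ν(P)`, while the disjoint sets
`t P` and `t² P` give `2 ν(P) ≤ ν(X ∖ P)`. -/
theorem not_isAmenableGroup_of_paradox {G Y : Type*} [Group G] [MulAction G Y] {X P : Set Y}
    {s t : G} (hX : X.Nonempty) (hs : s ∈ MulAction.stabilizer G X)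
    (ht : t ∈ MulAction.stabilizer G X) (hsP : ∀ x ∈ X, x ∉ P → s • x ∈ P)
    (htP : ∀ x ∈ X, x ∈ P → t • x ∉ P) (httP : ∀ x ∈ X, x ∈ P → t • t • x ∉ P) :
    ¬ IsAmenableGroup G := by
  rintro ⟨μ, hμ0, hμ1, hμadd, hμinv⟩
  obtain ⟨x₀, hx₀⟩ := hX
  let H := MulAction.stabilizer G X
  let q : G → Quotient (QuotientGroup.rightRel H) := Quotient.mk _
  let F : G → Y := fun g => (g * (q g).out⁻¹) • x₀
  have hF : ∀ g, F g ∈ X := fun g => by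
    have h : g * (q g).out⁻¹ ∈ H := QuotientGroup.rightRel_apply.1 (Quotient.mk_out g)
    exact (MulAction.mem_stabilizer_set.1 h x₀).2 hx₀
  have hFmul : ∀ h ∈ H, ∀ g, F (h * g) = h • F g := fun h hh g => by
    have : q (h * g) = q g := Quotient.sound (QuotientGroup.rightRel_apply.2 (by simpa using hh))
    simp only [F, this, mul_smul]
  have hmono : ∀ S T : Set G, S ⊆ T → μ S ≤ μ T := fun S T h => by
    have := hμadd S (T \ S) Set.disjoint_sdiff_right
    rw [Set.union_sdiff_cancel h] at this
    linarith [hμ0 (T \ S)]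
  have hcompl : μ (F ⁻¹' P) + μ (F ⁻¹' Pᶜ) = 1 := by
    rw [← hμadd _ _ (disjoint_compl_right.preimage F), ← Set.preimage_union, Set.union_compl_self,
      Set.preimage_univ, hμ1]
  have h1 : μ (F ⁻¹' Pᶜ) ≤ μ (F ⁻¹' P) := by
    rw [← hμinv s]
    apply hmono
    rintro _ ⟨g, hg, rfl⟩
    simpa only [Set.mem_preimage, hFmul s hs] using hsP _ (hF g) hg
  have hdisj : Disjoint ((fun g => t * g) '' (F ⁻¹' P))
      ((fun g => t * g) '' ((fun g => t * g) '' (F ⁻¹' P))) := by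
    rw [Set.disjoint_image_iff (mul_right_injective t), Set.disjoint_left]
    rintro _ hg ⟨g, hg', rfl⟩
    rw [Set.mem_preimage, hFmul t ht] at hg
    exact htP _ (hF g) hg' hg
  have h2 : μ (F ⁻¹' P) + μ (F ⁻¹' P) ≤ μ (F ⁻¹' Pᶜ) := by
    have := hμadd _ _ hdisj
    rw [hμinv, hμinv, hμinv] at this
    rw [← this]
    apply hmono
    rintro _ (⟨g, hg, rfl⟩ | ⟨_, ⟨g, hg, rfl⟩, rfl⟩)
    · simpa only [Set.mem_preimage, Set.mem_compl_iff, hFmul t ht] using htP _ (hF g) hg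
    · simpa only [Set.mem_preimage, Set.mem_compl_iff, hFmul t ht] using httP _ (hF g) hg
  linarith [hμ0 (F ⁻¹' P)]

section TwoTracks

variable (B : Fin 2 → Type*)

/-- The symbol of a two-track alphabet with components `a` and `b`. -/
def symbolPair (a : B 0) (b : B 1) : ∀ t, B t := (piFinTwoEquiv B).symm (a, b)

variable {B}

@[simp] theorem symbolPair_zero (a : B 0) (b : B 1) : symbolPair B a b 0 = a := rfl

@[simp] theorem symbolPair_one (a : B 0) (b : B 1) : symbolPair B a b 1 = b := rfl

theorem eq_symbolPair (c : ∀ t, B t) : c = symbolPair B (c 0) (c 1) :=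
  ((piFinTwoEquiv B).symm_apply_apply c).symm

@[simp] theorem symbolPair_inj {a a' : B 0} {b b' : B 1} :
    symbolPair B a b = symbolPair B a' b' ↔ a = a' ∧ b = b' := by
  simp [symbolPair]

@[simp] theorem update_symbolPair_zero (a a' : B 0) (b : B 1) :
    Function.update (symbolPair B a b) 0 a' = symbolPair B a' b := by
  rw [eq_symbolPair (Function.update _ _ _)]
  simp

@[simp] theorem update_symbolPair_one (a : B 0) (b b' : B 1) :
    Function.update (symbolPair B a b) 1 b' = symbolPair B a b' := by
  rw [eq_symbolPair (Function.update _ _ _)]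
  simp

end TwoTracks

/-- A transposition and a 3-cycle of `c₁, c₂, c₃` that fix all other symbols. -/
theorem exists_swap_and_cycle {A : Type*} {c₁ c₂ c₃ : A} (h12 : c₁ ≠ c₂) (h13 : c₁ ≠ c₃)
    (h23 : c₂ ≠ c₃) :
    ∃ σ τ : Equiv.Perm A, (∀ c, c ≠ c₁ → c ≠ c₂ → σ c = c) ∧ σ c₁ = c₂ ∧ σ c₂ = c₁ ∧
      (∀ c, c ≠ c₁ → c ≠ c₂ → c ≠ c₃ → τ c = c) ∧ τ c₁ = c₂ ∧ τ c₂ = c₃ ∧ τ c₃ = c₁ := by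
  classical
  refine ⟨Equiv.swap c₁ c₂, Equiv.swap c₁ c₃ * Equiv.swap c₁ c₂,
    fun c h h' => Equiv.swap_apply_of_ne_of_ne h h', Equiv.swap_apply_left _ _,
    Equiv.swap_apply_right _ _, fun c h h' h'' => ?_, ?_, ?_, ?_⟩
  · simp [Equiv.swap_apply_of_ne_of_ne h h', Equiv.swap_apply_of_ne_of_ne h h'']
  · simp [Equiv.swap_apply_of_ne_of_ne h12.symm h23]
  · simp
  · simp [Equiv.swap_apply_of_ne_of_ne h13.symm h23.symm]

/-- A permutation that maps a finite set into itself also reflects membership in it. -/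
theorem perm_mem_finset_iff {A : Type*} (π : Equiv.Perm A) {s : Finset A} (h : ∀ c ∈ s, π c ∈ s)
    (c : A) : π c ∈ s ↔ c ∈ s := by
  refine ⟨fun hc => ?_, h c⟩
  have := Finset.surj_on_of_inj_on_of_card_le (s := s) (t := s) (fun a _ => π a) h
    (fun _ _ _ _ h => π.injective h) le_rfl _ hc
  obtain ⟨d, hd, he⟩ := this
  exact π.injective he ▸ hd

section NonAmenable

variable {B : Fin 2 → Type*}

/-- The configurations over the four symbols with components in `{a₀, a₁}` and `{b₀, b₁}`, other
than the constant configuration `(a₀, b₀)`, that equal `(a₀, b₀)` in all cells far enough to the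
right. -/
def rightFiniteConfigs (a₀ a₁ : B 0) (b₀ b₁ : B 1) : Set (ℤ → ∀ t, B t) :=
  {x | (∀ j, (x j 0 = a₀ ∨ x j 0 = a₁) ∧ (x j 1 = b₀ ∨ x j 1 = b₁)) ∧
    (∃ N, ∀ j, N < j → x j = symbolPair B a₀ b₀) ∧ ∃ j, x j ≠ symbolPair B a₀ b₀}

/-- The configurations whose rightmost symbol other than `z` exists and is `c`. -/
def rightmostEq {A : Type*} (z c : A) : Set (ℤ → A) :=
  {x | ∃ N, x N = c ∧ c ≠ z ∧ ∀ j, N < j → x j = z}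

theorem mem_rightmostEq_unique {A : Type*} {z c c' : A} {x : ℤ → A} (h : x ∈ rightmostEq z c)
    (h' : x ∈ rightmostEq z c') : c = c' := by
  obtain ⟨N, hN, hc, h⟩ := h
  obtain ⟨N', hN', hc', h'⟩ := h'
  obtain hlt | rfl | hlt := lt_trichotomy N N'
  · exact absurd (hN'.symm.trans (h _ hlt)) hc'
  · exact hN.symm.trans hN'
  · exact absurd (hN.symm.trans (h' _ hlt)) hc

theorem exists_mem_rightmostEq {a₀ a₁ : B 0} {b₀ b₁ : B 1} {x : ℤ → ∀ t, B t}
    (hx : x ∈ rightFiniteConfigs a₀ a₁ b₀ b₁) :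
    x ∈ rightmostEq (symbolPair B a₀ b₀) (symbolPair B a₁ b₀) ∨
      x ∈ rightmostEq (symbolPair B a₀ b₀) (symbolPair B a₀ b₁) ∨
      x ∈ rightmostEq (symbolPair B a₀ b₀) (symbolPair B a₁ b₁) := by
  obtain ⟨hx, ⟨N, hN⟩, hne⟩ := hx
  obtain ⟨M, hM, hmax⟩ := Int.exists_greatest_of_bdd
    (P := fun j => x j ≠ symbolPair B a₀ b₀) ⟨N, fun j hj => not_lt.1 fun h => hj (hN j h)⟩ hne
  have hz : ∀ j, M < j → x j = symbolPair B a₀ b₀ := fun j hj => by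
    by_contra h; exact absurd (hmax j h) (not_le.2 hj)
  have hxM := eq_symbolPair (x M)
  obtain ⟨h0 | h0, h1 | h1⟩ := hx M <;> rw [h0, h1] at hxM
  · exact absurd hxM hM
  · exact .inr (.inl ⟨M, hxM, hxM ▸ hM, hz⟩)
  · exact .inl ⟨M, hxM, hxM ▸ hM, hz⟩
  · exact .inr (.inr ⟨M, hxM, hxM ▸ hM, hz⟩)

theorem map_mem_rightmostEq {A : Type*} {z c : A} {x : ℤ → A} (π : Equiv.Perm A) (hπ : π z = z)
    (hx : x ∈ rightmostEq z c) : (fun j => π (x j)) ∈ rightmostEq z (π c) := by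
  obtain ⟨N, hN, hc, h⟩ := hx
  exact ⟨N, congrArg π hN, fun h' => hc (π.injective (h'.trans hπ.symm)), fun j hj => by
    simp only [h j hj, hπ]⟩

theorem map_mem_rightFiniteConfigs_iff {a₀ a₁ : B 0} {b₀ b₁ : B 1} (π : Equiv.Perm (∀ t, B t))
    (hz : π (symbolPair B a₀ b₀) = symbolPair B a₀ b₀)
    (hπ : ∀ c, (π c 0 = a₀ ∨ π c 0 = a₁) ∧ (π c 1 = b₀ ∨ π c 1 = b₁) ↔
      (c 0 = a₀ ∨ c 0 = a₁) ∧ (c 1 = b₀ ∨ c 1 = b₁)) {x : ℤ → ∀ t, B t} :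
    (fun j => π (x j)) ∈ rightFiniteConfigs a₀ a₁ b₀ b₁ ↔ x ∈ rightFiniteConfigs a₀ a₁ b₀ b₁ := by
  have h : ∀ c, π c = symbolPair B a₀ b₀ ↔ c = symbolPair B a₀ b₀ := fun c => by
    conv_lhs => rw [← hz]
    exact π.apply_eq_iff_eq
  simp only [rightFiniteConfigs, Set.mem_ofPred_eq, ne_eq, h, hπ]

variable [∀ i, TopologicalSpace (B i)]

theorem partialShift_inv_mem_rightmostEq {a₀ a₁ : B 0} {b₀ b : B 1} (ha : a₁ ≠ a₀) {x : ℤ → ∀ t, B t}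
    (hx : x ∈ rightmostEq (symbolPair B a₀ b₀) (symbolPair B a₁ b)) :
    ((partialShift B 0)⁻¹).1 x ∈ rightmostEq (symbolPair B a₀ b₀) (symbolPair B a₁ b₀) := by
  obtain ⟨N, hN, -, h⟩ := hx
  refine ⟨N + 1, ?_, by simp [ha], fun j hj => ?_⟩
  · rw [partialShift_inv_apply, h _ (lt_add_one N), add_sub_cancel_right, hN]
    simp
  · rw [partialShift_inv_apply, h j (by omega), h (j - 1) (by omega)]
    simp

theorem partialShift_mem_rightFiniteConfigs_iff {a₀ a₁ : B 0} {b₀ b₁ : B 1} {x : ℤ → ∀ t, B t} :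
    (partialShift B 0).1 x ∈ rightFiniteConfigs a₀ a₁ b₀ b₁ ↔
      x ∈ rightFiniteConfigs a₀ a₁ b₀ b₁ := by
  have hz : ∀ c, c = symbolPair B a₀ b₀ ↔ c 0 = a₀ ∧ c 1 = b₀ := fun c => by
    rw [eq_symbolPair c]; simp
  have h0 : ∀ j, (partialShift B 0).1 x j 0 = x (j + 1) 0 := fun j => by simp [partialShift_apply]
  have h1 : ∀ j, (partialShift B 0).1 x j 1 = x j 1 := fun j => by simp [partialShift_apply]
  simp only [rightFiniteConfigs, Set.mem_ofPred_eq, ne_eq, hz, h0, h1]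
  refine and_congr ?_ (and_congr ?_ ?_)
  · refine ⟨fun h j => ⟨?_, (h j).2⟩, fun h j => ⟨(h _).1, (h j).2⟩⟩
    simpa using (h (j - 1)).1
  · constructor
    · rintro ⟨N, h⟩
      refine ⟨N + 1, fun j hj => ⟨?_, (h j (by omega)).2⟩⟩
      simpa using (h (j - 1) (by omega)).1
    · rintro ⟨N, h⟩
      exact ⟨N, fun j hj => ⟨(h _ (by omega)).1, (h j hj).2⟩⟩
  · simp only [← not_forall, not_iff_not]
    refine ⟨fun h j => ⟨?_, (h j).2⟩, fun h j => ⟨(h _).1, (h j).2⟩⟩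
    simpa using (h (j - 1)).1

variable [∀ i, DiscreteTopology (B i)]

/-- Automata act on configurations by evaluation. -/
instance : MulAction (PAut B) (ℤ → ∀ t, B t) where
  smul g x := g.1.1 x
  one_smul _ := rfl
  mul_smul _ _ _ := rfl

theorem not_isAmenableGroup_pAut [Nontrivial (B 0)] [Nontrivial (B 1)] :
    ¬ IsAmenableGroup (PAut B) := by
  classical
  obtain ⟨a₀, a₁, ha⟩ := exists_pair_ne (B 0)
  obtain ⟨b₀, b₁, hb⟩ := exists_pair_ne (B 1)
  obtain ⟨z, hz⟩ : ∃ z, z = symbolPair B a₀ b₀ := ⟨_, rfl⟩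
  obtain ⟨c₁, hc₁⟩ : ∃ c, c = symbolPair B a₁ b₀ := ⟨_, rfl⟩
  obtain ⟨c₂, hc₂⟩ : ∃ c, c = symbolPair B a₀ b₁ := ⟨_, rfl⟩
  obtain ⟨c₃, hc₃⟩ : ∃ c, c = symbolPair B a₁ b₁ := ⟨_, rfl⟩
  have hz1 : z ≠ c₁ := by simp [hz, hc₁, ha]
  have hz2 : z ≠ c₂ := by simp [hz, hc₂, hb]
  have hz3 : z ≠ c₃ := by simp [hz, hc₃, ha]
  have h12 : c₁ ≠ c₂ := by simp [hc₁, hc₂, ha.symm]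
  have h13 : c₁ ≠ c₃ := by simp [hc₁, hc₃, hb]
  have h23 : c₂ ≠ c₃ := by simp [hc₂, hc₃, ha]
  have hmem : ∀ c : ∀ t, B t, (c 0 = a₀ ∨ c 0 = a₁) ∧ (c 1 = b₀ ∨ c 1 = b₁) ↔
      c ∈ ({z, c₁, c₂, c₃} : Finset _) := fun c => by
    rw [eq_symbolPair c]
    simp only [hz, hc₁, hc₂, hc₃, symbolPair_inj, symbolPair_zero, symbolPair_one,
      Finset.mem_insert, Finset.mem_singleton]
    tauto
  obtain ⟨σ, τ, hσ, hσ1, hσ2, hτ, hτ1, hτ2, hτ3⟩ := exists_swap_and_cycle h12 h13 h23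
  have hσz := hσ z hz1 hz2
  have hσ3 := hσ c₃ h13.symm h23.symm
  have hτz := hτ z hz1 hz2 hz3
  have hσE := perm_mem_finset_iff σ (s := {z, c₁, c₂, c₃}) (by simp [hσz, hσ1, hσ2, hσ3])
  have hτE := perm_mem_finset_iff τ (s := {z, c₁, c₂, c₃}) (by simp [hτz, hτ1, hτ2, hτ3])
  let X := rightFiniteConfigs a₀ a₁ b₀ b₁
  let sh : PAut B := ⟨partialShift B 0, partialShift_mem B 0⟩
  let pσ : PAut B := ⟨symbolPerm B σ, symbolPerm_mem B σ⟩
  let t : PAut B := ⟨symbolPerm B τ, symbolPerm_mem B τ⟩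
  have hsh : sh ∈ MulAction.stabilizer (PAut B) X :=
    MulAction.mem_stabilizer_set.2 fun x => partialShift_mem_rightFiniteConfigs_iff
  have hpσ : pσ ∈ MulAction.stabilizer (PAut B) X :=
    MulAction.mem_stabilizer_set.2 fun x => map_mem_rightFiniteConfigs_iff σ (hz ▸ hσz) fun c => by
      rw [hmem, hmem, hσE]
  have ht : t ∈ MulAction.stabilizer (PAut B) X :=
    MulAction.mem_stabilizer_set.2 fun x => map_mem_rightFiniteConfigs_iff τ (hz ▸ hτz) fun c => by
      rw [hmem, hmem, hτE]
  have hσmap : ∀ {x c}, x ∈ rightmostEq z c → (symbolPerm B σ).1 x ∈ rightmostEq z (σ c) :=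
    fun hx => map_mem_rightmostEq σ hσz hx
  have hτmap : ∀ {x c}, x ∈ rightmostEq z c → (symbolPerm B τ).1 x ∈ rightmostEq z (τ c) :=
    fun hx => map_mem_rightmostEq τ hτz hx
  have hshift : ∀ {x b}, x ∈ rightmostEq z (symbolPair B a₁ b) →
      ((partialShift B 0)⁻¹).1 x ∈ rightmostEq z c₁ := fun hx => by
    rw [hz] at hx
    rw [hz, hc₁]
    exact partialShift_inv_mem_rightmostEq ha.symm hx
  have hX : ∀ x ∈ X, x ∈ rightmostEq z c₁ ∨ x ∈ rightmostEq z c₂ ∨ x ∈ rightmostEq z c₃ := by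
    rw [hz, hc₁, hc₂, hc₃]
    exact fun x => exists_mem_rightmostEq
  refine not_isAmenableGroup_of_paradox (X := X) (P := rightmostEq z c₁) (s := sh⁻¹ * pσ) (t := t)
    ⟨fun j => if j = 0 then c₁ else z, fun j => ?_, ⟨0, fun j hj => ?_⟩, ⟨0, ?_⟩⟩
    (mul_mem (inv_mem hsh) hpσ) ht (fun x hx hxP => ?_) (fun x _ hxP h => ?_)
    (fun x _ hxP h => ?_)
  · rw [hmem]
    split_ifs <;> simp
  · rw [← hz]
    exact if_neg hj.ne'
  · rw [← hz]
    exact hz1.symm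
  · change ((partialShift B 0)⁻¹).1 ((symbolPerm B σ).1 x) ∈ rightmostEq z c₁
    obtain h | h | h := hX x hx
    · exact absurd h hxP
    · apply hshift (b := b₀)
      rw [← hc₁, ← hσ2]
      exact hσmap h
    · apply hshift (b := b₁)
      rw [← hc₃, ← hσ3]
      exact hσmap h
  · have h' := hτmap hxP
    rw [hτ1] at h'
    exact h12 (mem_rightmostEq_unique h h')
  · have h' := hτmap (hτmap hxP)
    rw [hτ1, hτ2] at h'
    exact h13 (mem_rightmostEq_unique h h')

end NonAmenable

/-! ### Linear groups from faithful representations -/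

theorem isLinearGroup_of_representation.{z, u, w} {F : Type z} [Field F] {G : Type u} [Group G]
    {V : Type w} [AddCommGroup V] [Module F V] [FiniteDimensional F V] (ρ : Representation F G V)
    (hρ : Function.Injective ρ) : IsLinearGroup.{z} G := by
  let e := LinearMap.toMatrixAlgEquiv (Module.finBasis F V)
  refine ⟨F, inferInstance, Module.finrank F V,
    (Units.map e.toAlgHom.toRingHom.toMonoidHom).comp (MonoidHom.toHomUnits ρ), ?_⟩
  intro g h hgh
  exact hρ (e.injective (congrArg Units.val hgh))

/-! ### Two binary tracks: affine automata -/

section Affine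

variable {K : Type*} [Field K]

/-- Over the field with two elements, every permutation of the plane is affine: the four points
`0, u, v, u + v` are all points as soon as they are distinct, and the sum of all points is `0`. -/
theorem perm_add_of_card_eq_two (hK : Nat.card K = 2) (π : Equiv.Perm (Fin 2 → K))
    (u v : Fin 2 → K) : π (u + v) = π u + π v - π 0 := by
  classical
  have : Finite K := Nat.finite_of_card_ne_zero (by omega)
  have : Fintype K := Fintype.ofFinite K
  have hcard : Fintype.card K = 2 := by rw [← hK, Nat.card_eq_fintype_card]
  have : CharP K 2 := by
    obtain ⟨p, hp⟩ := CharP.exists K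
    have h2 : ((2 : ℕ) : K) = 0 := by rw [← hcard]; exact FiniteField.cast_card_eq_zero K
    have hp2 := (CharP.cast_eq_zero_iff K p 2).1 h2
    obtain rfl | rfl := (Nat.dvd_prime Nat.prime_two).1 hp2
    · exact absurd rfl (CharP.char_ne_one K 1)
    · exact hp
  have hself : ∀ w : Fin 2 → K, w + w = 0 := fun w => funext fun i => CharTwo.add_self_eq_zero _
  have hneg : ∀ w : Fin 2 → K, -w = w := fun w => neg_eq_of_add_eq_zero_left (hself w)
  rw [sub_eq_add_neg, hneg]
  by_cases hu : u = 0
  · subst hu; rw [zero_add, add_comm (π 0), add_assoc, hself, add_zero]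
  by_cases hv : v = 0
  · subst hv; rw [add_zero, add_assoc, hself, add_zero]
  by_cases huv : u = v
  · subst huv; rw [hself, hself, zero_add]
  have h1 : u + v ≠ 0 := fun h => huv (by rw [← sub_eq_zero, sub_eq_add_neg, hneg, h])
  have huniv : ({0, u, v, u + v} : Finset (Fin 2 → K)) = Finset.univ := by
    apply Finset.eq_univ_of_card
    rw [Finset.card_insert_of_notMem, Finset.card_insert_of_notMem, Finset.card_pair]
    · simp [hcard]
    · simpa using hu
    · simp [huv, hv]
    · simp [Ne.symm hu, Ne.symm hv, Ne.symm h1]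
  have hsum : ∀ ρ : Equiv.Perm (Fin 2 → K), ρ 0 + (ρ u + (ρ v + ρ (u + v))) = ∑ a, a := fun ρ => by
    rw [← Equiv.sum_comp ρ, ← huniv, Finset.sum_insert, Finset.sum_insert, Finset.sum_pair]
    · simpa using hu
    · simp [huv, hv]
    · simp [Ne.symm hu, Ne.symm hv, Ne.symm h1]
  have h0 := hsum 1
  simp only [Equiv.Perm.one_apply, zero_add] at h0
  rw [show u + (v + (u + v)) = 0 by rw [← add_assoc, hself]] at h0
  have h := hsum π
  rw [← h0, ← add_assoc, ← add_assoc, add_eq_zero_iff_eq_neg, hneg] at h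
  rw [← h]; abel

open HahnSeries

/-- A pair of Laurent series, read as the configuration of its coefficients. -/
def seriesConfig (v : Fin 2 → HahnSeries ℤ K) : ℤ → Fin 2 → K := fun j t => (v t).coeff j

theorem seriesConfig_injective : Function.Injective (seriesConfig (K := K)) := fun _ _ h =>
  funext fun t => HahnSeries.ext (funext fun j => congrFun (congrFun h j) t)

theorem seriesConfig_map_C_mulVec (N : Matrix (Fin 2) (Fin 2) K) (v : Fin 2 → HahnSeries ℤ K)
    (j : ℤ) : seriesConfig ((N.map C).mulVec v) j = N.mulVec (seriesConfig v j) := by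
  funext t
  simp [seriesConfig, Matrix.mulVec, dotProduct, C_apply]

theorem exists_seriesConfig_eq_of_bddBelow {x : ℤ → Fin 2 → K} (n : ℤ) (hx : ∀ j < n, x j = 0) :
    ∃ v, seriesConfig v = x :=
  ⟨fun t => ofSuppBddBelow (fun j => x j t) ⟨n, fun j hj => by
    by_contra h
    exact hj (congrFun (hx j (not_le.1 h)) t)⟩, rfl⟩

/-- The linear part of a permutation of the plane over the field with two elements: additive maps
are linear there, since `0` and `1` are the only scalars. -/
theorem exists_generalLinearGroup_of_perm (hK : Nat.card K = 2) (π : Equiv.Perm (Fin 2 → K)) :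
    ∃ N : GL (Fin 2) K, ∀ a, π a = N.1.mulVec a + π 0 := by
  have hscalar : ∀ c : K, c = 0 ∨ c = 1 := fun c => by
    by_contra! h
    have : Finite K := Nat.finite_of_card_ne_zero (by omega)
    have : Fintype K := Fintype.ofFinite K
    classical
    have := Finset.card_le_univ ({0, 1, c} : Finset K)
    rw [Finset.card_insert_of_notMem (by simp [h.1.symm]), Finset.card_pair h.2.symm,
      ← Nat.card_eq_fintype_card] at this
    omega
  let L : (Fin 2 → K) →ₗ[K] (Fin 2 → K) :=
    { toFun a := π a - π 0
      map_add' u v := by rw [perm_add_of_card_eq_two hK]; abel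
      map_smul' c u := by obtain rfl | rfl := hscalar c <;> simp }
  have hL : Function.Injective L := fun u v h => π.injective (sub_left_injective h)
  refine ⟨Matrix.GeneralLinearGroup.toLin.symm
    (LinearMap.GeneralLinearGroup.ofLinearEquiv (LinearEquiv.ofInjectiveEndo L hL)), fun a => ?_⟩
  change π a = (LinearMap.toMatrix' L).mulVec a + π 0
  rw [LinearMap.toMatrix'_mulVec]
  exact (sub_add_cancel _ _).symm

variable [TopologicalSpace K]

/-- The automaton `g` is affine over `K`, and on configurations given by Laurent series its linear
part is the matrix `N`. -/
structure HasLinearPart (g : RCA (Fin 2 → K)) (N : GL (Fin 2) (HahnSeries ℤ K)) : Prop where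
  map_add : ∀ x y, g.1 (x + y) = g.1 x + g.1 y - g.1 0
  map_seriesConfig : ∀ v, g.1 (seriesConfig v) = seriesConfig (N.1.mulVec v) + g.1 0

namespace HasLinearPart

variable {g g' : RCA (Fin 2 → K)} {N N' : GL (Fin 2) (HahnSeries ℤ K)}

theorem mul (h : HasLinearPart g N) (h' : HasLinearPart g' N') :
    HasLinearPart (g * g') (N * N') where
  map_add x y := by
    have h1 := h.map_add (g'.1 (x + y)) (g'.1 0)
    have h2 : g'.1 (x + y) + g'.1 0 = g'.1 x + g'.1 y := by rw [h'.map_add]; abel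
    rw [h2, h.map_add] at h1
    simp only [RCA.mul_apply]
    rw [← sub_eq_iff_eq_add.2 (sub_eq_iff_eq_add.1 h1.symm).symm]
    abel
  map_seriesConfig v := by
    rw [RCA.mul_apply, RCA.mul_apply, h'.map_seriesConfig, h.map_add, h.map_seriesConfig,
      Units.val_mul, Matrix.mulVec_mulVec]
    abel

theorem one : HasLinearPart (1 : RCA (Fin 2 → K)) 1 where
  map_add x y := (sub_zero (x + y)).symm
  map_seriesConfig v := by
    rw [Units.val_one, Matrix.one_mulVec]
    exact (add_zero (seriesConfig v)).symm

theorem inv (h : HasLinearPart g N) : HasLinearPart g⁻¹ N⁻¹ where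
  map_add x y := by
    apply g.1.injective
    have h1 := h.map_add ((g⁻¹).1 x + (g⁻¹).1 y - (g⁻¹).1 0) ((g⁻¹).1 0)
    rw [sub_add_cancel, h.map_add] at h1
    simp only [RCA.apply_inv_apply] at h1 ⊢
    rw [add_zero] at h1
    exact (sub_left_injective h1)
  map_seriesConfig v := by
    apply g.1.injective
    rw [h.map_add, h.map_seriesConfig, RCA.apply_inv_apply, RCA.apply_inv_apply,
      Matrix.mulVec_mulVec, ← Units.val_mul, mul_inv_cancel, Units.val_one, Matrix.one_mulVec]
    abel

theorem unique (h : HasLinearPart g N) (h' : HasLinearPart g N') : N = N' :=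
  Units.ext (Matrix.mulVec_injective (funext fun v => seriesConfig_injective
    (add_left_injective (g.1 0) ((h.map_seriesConfig v).symm.trans (h'.map_seriesConfig v)))))

end HasLinearPart

theorem hasLinearPart_partialShift (i : Fin 2) :
    ∃ N, HasLinearPart (partialShift (fun _ : Fin 2 => K) i) N := by
  -- The shift `x_i ↦ x_{i+1}` lowers all exponents by one.
  let d : Fin 2 → HahnSeries ℤ K := fun t => if t = i then single (-1) 1 else 1
  have hd : ∀ t, d t ≠ 0 := fun t => by
    simp only [d]
    split_ifs
    · exact single_ne_zero one_ne_zero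
    · exact one_ne_zero
  refine ⟨Matrix.GeneralLinearGroup.mkOfDetNeZero (Matrix.diagonal d) ?_, fun x y => ?_, fun v => ?_⟩
  · rw [Matrix.det_diagonal]
    exact Finset.prod_ne_zero_iff.2 fun t _ => hd t
  · funext j t
    by_cases ht : t = i
    · subst ht; simp [partialShift_apply]
    · simp [partialShift_apply, ht]
  · funext j t
    have h0 : (partialShift (fun _ : Fin 2 => K) i).1 0 = 0 := by
      funext j; simp [partialShift_apply]
    rw [h0, add_zero]
    change _ = ((Matrix.diagonal d).mulVec v t).coeff j
    rw [Matrix.mulVec_diagonal, partialShift_apply]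
    by_cases ht : t = i
    · subst ht
      simp [seriesConfig, d, coeff_single_mul]
    · simp [seriesConfig, d, ht]

variable [DiscreteTopology K]

theorem hasLinearPart_symbolPerm (hK : Nat.card K = 2) (π : Equiv.Perm (Fin 2 → K)) :
    ∃ N, HasLinearPart (symbolPerm (fun _ : Fin 2 => K) π) N := by
  obtain ⟨N, hN⟩ := exists_generalLinearGroup_of_perm hK π
  refine ⟨Matrix.GeneralLinearGroup.map C N, fun x y => ?_, fun v => ?_⟩
  · funext j
    exact perm_add_of_card_eq_two hK π (x j) (y j)
  · funext j
    refine (hN _).trans (congrArg (· + π 0) ?_)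
    exact (seriesConfig_map_C_mulVec N.1 v j).symm

theorem exists_hasLinearPart (hK : Nat.card K = 2) {g : RCA (Fin 2 → K)}
    (hg : g ∈ PAut fun _ : Fin 2 => K) : ∃ N, HasLinearPart g N := by
  induction hg using Subgroup.closure_induction with
  | mem g hg =>
    obtain ⟨i, rfl⟩ | ⟨π, rfl⟩ := hg
    · exact hasLinearPart_partialShift i
    · exact hasLinearPart_symbolPerm hK π
  | one => exact ⟨1, .one⟩
  | mul _ _ _ _ h h' =>
    obtain ⟨N, h⟩ := h
    obtain ⟨N', h'⟩ := h'
    exact ⟨_, h.mul h'⟩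
  | inv _ _ h =>
    obtain ⟨N, h⟩ := h
    exact ⟨_, h.inv⟩

theorem HasLinearPart.eq_one {g : RCA (Fin 2 → K)} (h : HasLinearPart g 1) (h0 : g.1 0 = 0) :
    g = 1 := by
  refine Subtype.ext (Homeomorph.ext fun x => ?_)
  -- Left-bounded configurations are dense.
  let y : ℕ → ℤ → Fin 2 → K := fun n j => if j < -n then 0 else x j
  have hy : ∀ n, g.1 (y n) = y n := fun n => by
    obtain ⟨v, hv⟩ := exists_seriesConfig_eq_of_bddBelow (x := y n) (-n) fun j hj => if_pos hj
    rw [← hv, h.map_seriesConfig, h0, Units.val_one, Matrix.one_mulVec, add_zero]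
  have hlim : Filter.Tendsto y Filter.atTop (nhds x) := by
    refine tendsto_pi_nhds.2 fun j => tendsto_const_nhds.congr' ?_
    filter_upwards [Filter.eventually_ge_atTop (-j).toNat] with n hn
    exact (if_neg (by omega)).symm
  have hlim' := (g.1.continuous.tendsto x).comp hlim
  exact tendsto_nhds_unique hlim' (hlim.congr fun n => (hy n).symm)

end Affine

/-! ### The action on constant configurations -/

section Constant

variable {A : Type*} [TopologicalSpace A]

theorem RCA.apply_const (g : RCA A) (a : A) : g.1 (fun _ => a) = fun _ => g.1 (fun _ => a) 0 := by
  have h : ∀ j, g.1 (fun _ => a) j = g.1 (fun _ => a) (j + 1) := congrFun (RCA.apply_shift g fun _ => a)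
  funext j
  induction j with
  | zero => rfl
  | succ j ih => rw [← h, ih]
  | pred j ih => rw [h, sub_add_cancel, ih]

/-- Automata permute the constant configurations, hence act linearly on the `F`-valued functions
of these; a constant configuration is identified with its symbol. -/
def constRepresentation (F A : Type*) [Field F] [TopologicalSpace A] :
    Representation F (RCA A) (A → F) where
  toFun g := LinearMap.funLeft F F fun a => (g⁻¹).1 (fun _ => a) 0
  map_one' := rfl
  map_mul' g h := by
    refine LinearMap.ext fun φ => funext fun a => congrArg φ ?_
    change (h⁻¹).1 ((g⁻¹).1 fun _ => a) 0 = _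
    rw [RCA.apply_const g⁻¹]

theorem apply_const_of_constRepresentation_eq_one {F : Type*} [Field F] {g : RCA A}
    (h : constRepresentation F A g = 1) (a : A) : g.1 (fun _ => a) = fun _ => a := by
  classical
  have h' := congrFun (LinearMap.congr_fun h (Pi.single a 1)) a
  change (Pi.single a 1 : A → F) ((g⁻¹).1 (fun _ => a) 0) = (Pi.single a 1 : A → F) a at h'
  have ha : (g⁻¹).1 (fun _ => a) 0 = a := by
    by_contra hne
    rw [Pi.single_eq_same, Pi.single_eq_of_ne hne] at h'
    exact zero_ne_one h'
  conv_lhs => rw [← ha, ← RCA.apply_const g⁻¹, RCA.apply_inv_apply]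

end Constant

theorem isLinearGroup_pAut_of_card_eq_two {K : Type} [Field K] [TopologicalSpace K]
    [DiscreteTopology K] (hK : Nat.card K = 2) : IsLinearGroup.{0} (PAut fun _ : Fin 2 => K) := by
  choose N hN using fun g : PAut fun _ : Fin 2 => K => exists_hasLinearPart hK g.2
  let ν : (PAut fun _ : Fin 2 => K) →* GL (Fin 2) (HahnSeries ℤ K) :=
    MonoidHom.mk' N fun g h => (hN (g * h)).unique ((hN g).mul (hN h))
  let ρ₁ : Representation (HahnSeries ℤ K) (PAut fun _ : Fin 2 => K) (Fin 2 → HahnSeries ℤ K) :=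
    (Matrix.toLinAlgEquiv' (R := HahnSeries ℤ K) (n := Fin 2)).toAlgHom.toRingHom.toMonoidHom.comp
      ((Units.coeHom _).comp ν)
  let ρ₂ : Representation (HahnSeries ℤ K) (PAut fun _ : Fin 2 => K)
      ((Fin 2 → K) → HahnSeries ℤ K) := (constRepresentation _ _).comp (PAut _).subtype
  have : Finite K := Nat.finite_of_card_ne_zero (by omega)
  refine isLinearGroup_of_representation (ρ₁.prod ρ₂) ((injective_iff_map_eq_one _).2 fun g hg => ?_)
  have h1 : ρ₁ g = 1 := LinearMap.ext fun v =>
    congrArg Prod.fst (LinearMap.congr_fun hg (v, 0))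
  have h2 : ρ₂ g = 1 := LinearMap.ext fun v =>
    congrArg Prod.snd (LinearMap.congr_fun hg (0, v))
  have hN1 : N g = 1 := Units.ext (Matrix.toLinAlgEquiv'.injective (h1.trans (map_one _).symm))
  exact Subtype.ext ((hN1 ▸ hN g).eq_one (apply_const_of_constRepresentation_eq_one h2 0))

theorem isLinearGroup_pAutN_two_two : IsLinearGroup.{0} (PAutN ![2, 2]) := by
  have h : ![2, 2] = fun _ : Fin 2 => 2 := by ext i; fin_cases i <;> rfl
  rw [h]
  let _ : Field (Fin 2) := inferInstanceAs (Field (ZMod 2))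
  exact isLinearGroup_pAut_of_card_eq_two (K := Fin 2) (by simp)

/-! ### Ladders of commutation in products of linear groups -/

/-- In a group of matrices, adding the elements `b 0, b 1, …` one at a time shrinks the subspace of
matrices commuting with all of them, so this must become stationary. If `a i` commutes with
`b 0, …, b (i - 1)` but not with `b i`, it never does; finitely many factors only require a
common index. -/
theorem not_isSubdirectProductOfLinearGroups_of_ladder.{w, u} {G : Type u} [Group G] (a b : ℕ → G)
    (hab : ∀ i j, j < i → Commute (a i) (b j)) (hne : ∀ i, ¬ Commute (a i) (b i)) :
    ¬ IsSubdirectProductOfLinearGroups.{w} G := by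
  rintro ⟨r, H, _, f, hH, hf⟩
  have key : ∀ i : Fin r, ∃ N, ∀ n, N ≤ n → Commute (f (a n) i) (f (b n) i) := by
    intro i
    obtain ⟨F, _, d, φ, hφ⟩ := hH i
    let ψ : G → Matrix (Fin d) (Fin d) F := fun g => (φ (f g i)).1
    have hψ : ∀ g h, Commute (ψ g) (ψ h) ↔ Commute (f g i) (f h i) := fun g h => by
      rw [Commute, Commute, SemiconjBy, SemiconjBy, ← hφ.eq_iff, Units.ext_iff, map_mul, map_mul,
        Units.val_mul, Units.val_mul]
    let V : ℕ →o (Submodule F (Matrix (Fin d) (Fin d) F))ᵒᵈ :=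
      { toFun n := OrderDual.toDual
          { carrier := {m | ∀ j, j < n → Commute m (ψ (b j))}
            add_mem' := fun hm hm' j hj => (hm j hj).add_left (hm' j hj)
            zero_mem' := fun _ _ => Commute.zero_left _
            smul_mem' := fun c _ hm j hj => (hm j hj).smul_left c }
        monotone' n n' h m hm j hj := hm j (hj.trans_le h) }
    obtain ⟨N, hN⟩ := IsArtinian.monotone_stabilizes V
    refine ⟨N, fun n hn => (hψ _ _).1 ?_⟩
    have h1 : ψ (a n) ∈ OrderDual.ofDual (V n) := fun j hj =>
      (hψ _ _).2 (((hab n j hj).map f).map (Pi.evalMonoidHom H i))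
    rw [← hN n hn, hN (n + 1) (by omega)] at h1
    exact h1 n (Nat.lt_succ_self n)
  choose N hN using key
  let n := Finset.univ.sup N
  refine hne n (hf ?_)
  funext i
  rw [map_mul, map_mul]
  exact hN i n (Finset.le_sup (Finset.mem_univ i))

/-! ### Controlled permutations of the second track -/

section Controlled

variable {B : Fin 2 → Type*} [∀ i, TopologicalSpace (B i)]

/-- The automaton `g` keeps the first track, and applies in each cell `j` the permutation
`f (x_{j + ·})` to the second track, where `x` is the first track. -/
def IsControlled (g : RCA (∀ t, B t)) (f : (ℤ → B 0) → Equiv.Perm (B 1)) : Prop :=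
  ∀ x j, g.1 x j = symbolPair B (x j 0) (f (fun i => x (j + i) 0) (x j 1))

namespace IsControlled

variable {g g' : RCA (∀ t, B t)} {f f' : (ℤ → B 0) → Equiv.Perm (B 1)}

theorem mul (h : IsControlled g f) (h' : IsControlled g' f') :
    IsControlled (g * g') (fun y => f y * f' y) := fun x j => by
  simp [h _ j, h' x]

theorem eq_inv_apply (h : IsControlled g f) (x : ℤ → ∀ t, B t) :
    (g⁻¹).1 x = fun j => symbolPair B (x j 0) ((f (fun i => x (j + i) 0))⁻¹ (x j 1)) := by
  conv_rhs => rw [← RCA.inv_apply_apply g (fun j => symbolPair B _ _)]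
  congr 1
  funext j
  rw [h, eq_symbolPair (x j)]
  simp

theorem inv (h : IsControlled g f) : IsControlled g⁻¹ (fun y => (f y)⁻¹) :=
  fun x _ => by rw [h.eq_inv_apply x]

theorem conj_partialShift (h : IsControlled g f) :
    IsControlled ((partialShift B 0)⁻¹ * g * partialShift B 0) (fun y => f fun i => y (i + 1)) :=
  fun x j => by
    rw [RCA.mul_apply, RCA.mul_apply, partialShift_inv_apply, h, h]
    simp [partialShift_apply, add_assoc]

theorem commute_iff [Nonempty (B 1)] (h : IsControlled g f) (h' : IsControlled g' f') :
    Commute g g' ↔ ∀ y, Commute (f y) (f' y) := by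
  constructor
  · intro hc y
    ext c
    have := congrArg (fun g : RCA (∀ t, B t) => g.1 (fun j => symbolPair B (y j) c) 0 1) hc.eq
    rw [(h.mul h') _ 0, (h'.mul h) _ 0] at this
    simpa using this
  · intro hc
    refine RCA.ext_apply fun x j => ?_
    rw [(h.mul h') x j, (h'.mul h) x j]
    dsimp only
    rw [(hc _).eq]

end IsControlled

variable [∀ i, DiscreteTopology (B i)]

variable (B) in
/-- The rules `f` for which the corresponding controlled automaton lies in `PAut`. -/
def controlledRules : Subgroup ((ℤ → B 0) → Equiv.Perm (B 1)) where
  carrier := {f | ∃ g ∈ PAut B, IsControlled g f}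
  mul_mem' := fun ⟨g, hg, h⟩ ⟨g', hg', h'⟩ => ⟨g * g', mul_mem hg hg', h.mul h'⟩
  one_mem' := ⟨1, one_mem _, fun x j => eq_symbolPair (x j)⟩
  inv_mem' := fun ⟨g, hg, h⟩ => ⟨g⁻¹, inv_mem hg, h.inv⟩

theorem cell_mem_controlledRules (φ : B 0 → Equiv.Perm (B 1)) (n : ℕ) :
    (fun y => φ (y n)) ∈ controlledRules B := by
  suffices h : ∃ g ∈ PAut B, IsControlled g (fun y => φ (y n)) from h
  induction n with
  | zero =>
    refine ⟨_, symbolPerm_mem B (((piFinTwoEquiv B).symm.permCongr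
      (Equiv.prodShear (Equiv.refl _) φ))), fun x j => ?_⟩
    rw [symbolPerm_apply]
    simp [symbolPair, Equiv.permCongr_apply]
  | succ n ih =>
    obtain ⟨g, hg, h⟩ := ih
    refine ⟨_, mul_mem (mul_mem (inv_mem (partialShift_mem B 0)) hg) (partialShift_mem B 0), ?_⟩
    simpa using h.conj_partialShift

open scoped Classical in
/-- If `β α β⁻¹ α⁻¹ = α`, then commutators of single-cell rules with `β` build rules that apply `α` under
a condition on arbitrarily many cells. -/
theorem word_mem_controlledRules {α β : Equiv.Perm (B 1)} (hαβ : β * α * β⁻¹ * α⁻¹ = α) (a : B 0) (n : ℕ) :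
    (fun y : ℤ → B 0 => if ∀ i < n, y i = a then α else 1) ∈ controlledRules B := by
  induction n with
  | zero => simpa using cell_mem_controlledRules (fun _ => α) 0
  | succ n ih =>
    have h := cell_mem_controlledRules (fun c => if c = a then β else 1) n
    convert mul_mem (mul_mem (mul_mem h ih) (inv_mem h)) (inv_mem ih) using 1
    funext y
    simp only [Pi.mul_apply, Pi.inv_apply, Nat.forall_lt_succ_right]
    by_cases h2 : ∀ i < n, y i = a
    · by_cases h1 : y n = a
      · simp only [h1, and_true, if_pos h2, if_true, hαβ]
      · simp [h1]
    · simp [h2]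

theorem not_isSubdirectProductOfLinearGroups_pAut.{w} [Nontrivial (B 0)] {c₁ c₂ c₃ : B 1}
    (h12 : c₁ ≠ c₂) (h13 : c₁ ≠ c₃) (h23 : c₂ ≠ c₃) :
    ¬ IsSubdirectProductOfLinearGroups.{w} (PAut B) := by
  classical
  have : Nonempty (B 1) := ⟨c₁⟩
  obtain ⟨a₀, a₁, ha⟩ := exists_pair_ne (B 0)
  obtain ⟨β, α, hβ, hβ1, hβ2, hα, hα1, hα2, hα3⟩ := exists_swap_and_cycle h12 h13 h23
  have hβ3 := hβ c₃ h13.symm h23.symm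
  have hmul : β * α = α * α * β := by
    ext c
    by_cases e1 : c = c₁
    · simp [*]
    by_cases e2 : c = c₂
    · simp [*]
    by_cases e3 : c = c₃
    · simp [*]
    simp [hα c e1 e2 e3, hβ c e1 e2]
  have hαβ : β * α * β⁻¹ * α⁻¹ = α := by
    rw [hmul, mul_inv_cancel_right, mul_inv_cancel_right]
  have hne : ¬ Commute α β := fun h => by
    have := congrArg (fun π : Equiv.Perm (B 1) => π c₁) h.eq
    simp [hα1, hβ1, hβ2, hα2] at this
    exact h13 this.symm
  choose a ha_mem ha_rule using word_mem_controlledRules hαβ a₀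
  choose b hb_mem hb_rule using cell_mem_controlledRules fun c => if c = a₁ then β else 1
  refine not_isSubdirectProductOfLinearGroups_of_ladder (G := PAut B)
    (fun n => ⟨a n, ha_mem n⟩) (fun n => ⟨b n, hb_mem n⟩) (fun i j hji => ?_) fun i h => ?_
  · refine Subtype.ext (((ha_rule i).commute_iff (hb_rule j)).2 fun y => ?_).eq
    by_cases h1 : ∀ k < i, y k = a₀
    · -- Cell `j` carries `a₀`, so the second rule is inactive.
      have : y j ≠ a₁ := by rw [h1 j hji]; exact ha
      simp [this]
    · simp only [if_neg h1, Commute.one_left]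
  · have h' : Commute (a i) (b i) := congrArg Subtype.val h.eq
    have := ((ha_rule i).commute_iff (hb_rule i)).1 h' fun k => if k = i then a₁ else a₀
    rw [if_pos fun k hk => if_neg (by omega), if_pos (if_pos rfl)] at this
    exact hne this

end Controlled

/-! ### The four cases -/

theorem theorem2 :
    (∀ m : ℕ, 1 ≤ m → Nonempty (PAutN ![m] ≃* PAutN ![1, m])) ∧
    (∀ m : ℕ, 2 ≤ m → Nonempty (PAutN ![m] ≃* Multiplicative ℤ × Equiv.Perm (Fin m)) ∧
      Nonempty (PAutN ![1, m] ≃* Multiplicative ℤ × Equiv.Perm (Fin m))) ∧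
    (∀ m n : ℕ, 2 ≤ m → 2 ≤ n → ¬ IsAmenableGroup (PAutN ![m, n])) ∧
    IsLinearGroup.{0} (PAutN ![2, 2]) ∧
    (∀ m n : ℕ, 2 ≤ m → 3 ≤ n → ¬ IsSubdirectProductOfLinearGroups.{v} (PAutN ![m, n])) := by
  refine ⟨fun m hm => nonempty_pAutN_one_track_mulEquiv hm,
    fun m hm => ⟨nonempty_pAutN_one_track hm, nonempty_pAutN_trivial_track hm⟩,
    fun m n hm hn => ?_, isLinearGroup_pAutN_two_two, fun m n hm hn => ?_⟩
  · have : Nontrivial (Fin (![m, n] 0)) := Fin.nontrivial_iff_two_le.2 hm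
    have : Nontrivial (Fin (![m, n] 1)) := Fin.nontrivial_iff_two_le.2 hn
    exact not_isAmenableGroup_pAut
  · have : Nontrivial (Fin (![m, n] 0)) := Fin.nontrivial_iff_two_le.2 hm
    let c (i : ℕ) (hi : i < 3) : Fin (![m, n] 1) := ⟨i, lt_of_lt_of_le hi hn⟩
    have hc : ∀ i hi j hj, i ≠ j → c i hi ≠ c j hj := fun i hi j hj hij h => hij (Fin.mk.inj h)
    exact not_isSubdirectProductOfLinearGroups_pAut
      (hc 0 (by omega) 1 (by omega) (by omega)) (hc 0 (by omega) 2 (by omega) (by omega))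
      (hc 1 (by omega) 2 (by omega) (by omega))
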